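/- Let $(\mathcal C,\mathbb E,\mathfrak s)$ be an extriangulated category in the sense of Nakaoka and Palu: $\mathcal C$ is an additive category, $\mathbb E:\mathcal C^{\mathrm{op}}\times\mathcal C\to \mathrm{Ab}$ is a biadditive functor, and $\mathfrak s$ is an additive realization of $\mathbb E$, satisfying the axioms (ET3), (ET3)$^{\mathrm{op}}$, (ET4), (ET4)$^{\mathrm{op}}$. Assume that $\mathcal C$ has enough projectives and enough injectives. For $i\ge 1$ put $\mathbb E^{i}(X,Y)=\mathbb E(\Omega^{i-1}X,Y)$, where $\Omega^{j}X$ denotes a $j$-th syzygy of $X$, and for a full subcategory $\mathcal T\subseteq\mathcal C$ put $$\mathcal T^{\perp}=\{Y\in\mathcal C \mid \mathbb E^{i}(T,Y)=0 \text{ for all } i\ge 1 \text{ and all } T\in\mathcal T\}.$$ Fix an integer $n\ge 0$. A full additive subcategory $\mathcal T$ of $\mathcal C$, closed under isomorphisms and direct summands, is called a tilting subcategory (of projective dimension $n$) if (1) every object of $\mathcal T$ has projective dimension at most $n$, i.e. a projective resolution of length at most $n$; (2) $\mathcal T$ is a generator for $\mathcal T^{\perp}$, i.e. $\mathcal T\subseteq\mathcal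 T^{\perp}$ and for every $Y\in\mathcal T^{\perp}$ there is an $\mathbb E$-triangle $Y'\to T\to Y\dashrightarrow$ with $T\in\mathcal T$ and $Y'\in\mathcal T^{\perp}$. For tilting subcategories $\mathcal T_1,\mathcal T_2$ write $\mathcal T_1\le\mathcal T_2$ if $\mathcal T_1\subseteq\mathcal T_2^{\perp}$. Then $\le$ is a partial order (reflexive, transitive and antisymmetric) on the tilting subcategories of $\mathcal C$. -/

import Mathlib

open CategoryTheory CategoryTheory.Limits Opposite

universe w v u

namespace Extriang

section Sequences

variable {C : Type u} [Category.{v} C]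

/-- A sequence of morphisms `X ⟶ mid ⟶ Z` with prescribed end terms. -/
structure Seq (X Z : C) where
  mid : C
  inl : X ⟶ mid
  out : mid ⟶ Z

/-- Two sequences with the same end terms are equivalent if there is an isomorphism of the middle
terms compatible with the identities of the end terms. -/
def Seq.Equivalent {X Z : C} (σ τ : Seq X Z) : Prop :=
  ∃ b : σ.mid ≅ τ.mid, σ.inl ≫ b.hom = τ.inl ∧ b.hom ≫ τ.out = σ.out

theorem Seq.equivalence_equivalent (X Z : C) :
    Equivalence (Seq.Equivalent (X := X) (Z := Z)) where
  refl σ := ⟨Iso.refl _, by simp, by simp⟩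
  symm := by
    rintro σ τ ⟨b, h₁, h₂⟩
    exact ⟨b.symm, by simp [← h₁], by simp [← h₂]⟩
  trans := by
    rintro σ τ ρ ⟨b, h₁, h₂⟩ ⟨b', h₃, h₄⟩
    exact ⟨b ≪≫ b', by simp [← h₃, ← h₁], by simp [← h₂, ← h₄]⟩

/-- The setoid of equivalent sequences from `X` to `Z`. -/
def Seq.setoid (X Z : C) : Setoid (Seq X Z) := ⟨Seq.Equivalent, Seq.equivalence_equivalent X Z⟩

/-- The equivalence classes of sequences `X ⟶ Y ⟶ Z`. -/
def SeqClass (X Z : C) : Type max u v := Quotient (Seq.setoid X Z)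

/-- The class `[X ⟶ Y ⟶ Z]`. -/
def SeqClass.mk {X Y Z : C} (x : X ⟶ Y) (y : Y ⟶ Z) : SeqClass X Z :=
  Quotient.mk (Seq.setoid X Z) ⟨Y, x, y⟩

end Sequences

section Extensions

variable {C : Type u} [Category.{v} C] (E : Cᵒᵖ ⥤ C ⥤ AddCommGrpCat.{w})

/-- The group `𝔼(Z, X)` of extensions (contravariant in `Z`, covariant in `X`). -/
abbrev Ext (Z X : C) : Type w := (E.obj (op Z)).obj X

variable {E}

/-- The extension `a_* δ`. -/
def push {Z X X' : C} (a : X ⟶ X') (δ : Ext E Z X) : Ext E Z X' := (E.obj (op Z)).map a δ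

/-- The extension `c^* δ`. -/
def pull {Z Z' X : C} (c : Z' ⟶ Z) (δ : Ext E Z X) : Ext E Z' X := (E.map c.op).app X δ

/-- The direct sum `δ ⊕ δ'` in `𝔼(Z ⊕ Z', X ⊕ X')`: the extension with components `δ`, `0`, `0`,
`δ'` in the decomposition given by biadditivity. -/
noncomputable def directSum [Preadditive C] [HasBinaryBiproducts C] {Z X Z' X' : C}
    (δ : Ext E Z X) (δ' : Ext E Z' X') : Ext E (Z ⊞ Z') (X ⊞ X') :=
  push (biprod.inl : X ⟶ X ⊞ X') (pull (biprod.fst : Z ⊞ Z' ⟶ Z) δ) +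
    push (biprod.inr : X' ⟶ X ⊞ X') (pull (biprod.snd : Z ⊞ Z' ⟶ Z') δ')

end Extensions

/-- An external triangulation of an additive category `C`: a biadditive functor
`𝔼 : Cᵒᵖ × C ⥤ Ab` (ET1), an additive realization `s` of `𝔼` (ET2), and the axioms (ET3), (ET3)ᵒᵖ,
(ET4), (ET4)ᵒᵖ. An extriangulated category is an additive category with such a structure. -/
structure Extriangulation (C : Type u) [Category.{v} C] [Preadditive C]
    [HasZeroObject C] [HasBinaryBiproducts C] where
  /-- The bifunctor of extensions. -/
  E : Cᵒᵖ ⥤ C ⥤ AddCommGrpCat.{w}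
  additive_right : ∀ Z : C, (E.obj (op Z)).Additive
  additive_left : ∀ X : C, (E.flip.obj X).Additive
  /-- The realization. -/
  s : ∀ {Z X : C}, Ext E Z X → SeqClass X Z
  exists_mid : ∀ {Z X Z' X' Y Y' : C} (δ : Ext E Z X) (δ' : Ext E Z' X')
    (x : X ⟶ Y) (y : Y ⟶ Z) (x' : X' ⟶ Y') (y' : Y' ⟶ Z'),
    s δ = SeqClass.mk x y → s δ' = SeqClass.mk x' y' →
    ∀ (a : X ⟶ X') (c : Z ⟶ Z'), push a δ = pull c δ' →
    ∃ b : Y ⟶ Y', x ≫ b = a ≫ x' ∧ y ≫ c = b ≫ y'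
  s_zero : ∀ Z X : C, s (0 : Ext E Z X) =
    SeqClass.mk (biprod.inl : X ⟶ X ⊞ Z) (biprod.snd : X ⊞ Z ⟶ Z)
  s_directSum : ∀ {Z X Z' X' Y Y' : C} (δ : Ext E Z X) (δ' : Ext E Z' X')
    (x : X ⟶ Y) (y : Y ⟶ Z) (x' : X' ⟶ Y') (y' : Y' ⟶ Z'),
    s δ = SeqClass.mk x y → s δ' = SeqClass.mk x' y' →
    s (directSum δ δ') = SeqClass.mk (biprod.map x x') (biprod.map y y')
  et3 : ∀ {Z X Z' X' Y Y' : C} (δ : Ext E Z X) (δ' : Ext E Z' X')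
    (x : X ⟶ Y) (y : Y ⟶ Z) (x' : X' ⟶ Y') (y' : Y' ⟶ Z'),
    s δ = SeqClass.mk x y → s δ' = SeqClass.mk x' y' →
    ∀ (a : X ⟶ X') (b : Y ⟶ Y'), x ≫ b = a ≫ x' →
    ∃ c : Z ⟶ Z', push a δ = pull c δ' ∧ y ≫ c = b ≫ y'
  et3_op : ∀ {Z X Z' X' Y Y' : C} (δ : Ext E Z X) (δ' : Ext E Z' X')
    (x : X ⟶ Y) (y : Y ⟶ Z) (x' : X' ⟶ Y') (y' : Y' ⟶ Z'),
    s δ = SeqClass.mk x y → s δ' = SeqClass.mk x' y' →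
    ∀ (b : Y ⟶ Y') (c : Z ⟶ Z'), y ≫ c = b ≫ y' →
    ∃ a : X ⟶ X', push a δ = pull c δ' ∧ x ≫ b = a ≫ x'
  et4 : ∀ {X Y D Z F : C} (δ : Ext E D X) (δ' : Ext E F Y)
    (f : X ⟶ Y) (f' : Y ⟶ D) (g : Y ⟶ Z) (g' : Z ⟶ F),
    s δ = SeqClass.mk f f' → s δ' = SeqClass.mk g g' →
    ∃ (W : C) (d : D ⟶ W) (e : W ⟶ F) (h : X ⟶ Z) (h' : Z ⟶ W) (δ'' : Ext E W X),
      f ≫ g = h ∧ f' ≫ d = g ≫ h' ∧ h' ≫ e = g' ∧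
      s δ'' = SeqClass.mk h h' ∧
      s (push f' δ') = SeqClass.mk d e ∧
      pull d δ'' = δ ∧
      push f δ'' = pull e δ'
  et4_op : ∀ {D X Y F Z : C} (δ : Ext E Y D) (δ' : Ext E Z F)
    (f' : D ⟶ X) (f : X ⟶ Y) (g' : F ⟶ Y) (g : Y ⟶ Z),
    s δ = SeqClass.mk f' f → s δ' = SeqClass.mk g' g →
    ∃ (W : C) (d : D ⟶ W) (e : W ⟶ F) (h' : W ⟶ X) (h : X ⟶ Z) (δ'' : Ext E Z W),
      d ≫ h' = f' ∧ e ≫ g' = h' ≫ f ∧ f ≫ g = h ∧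
      s δ'' = SeqClass.mk h' h ∧
      s (pull g' δ) = SeqClass.mk d e ∧
      δ' = push e δ'' ∧
      push d δ = pull g δ''

namespace Extriangulation

variable {C : Type u} [Category.{v} C] [Preadditive C] [HasZeroObject C] [HasBinaryBiproducts C]
  (S : Extriangulation.{w} C)

/-- `X ⟶ Y ⟶ Z` is a conflation: it realizes some extension in `𝔼(Z, X)`, i.e. it is the sequence
underlying an `𝔼`-triangle. -/
def Conflation {X Y Z : C} (x : X ⟶ Y) (y : Y ⟶ Z) : Prop :=
  ∃ δ : Ext S.E Z X, S.s δ = SeqClass.mk x y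

/-- Projective objects: morphisms from `P` lift along the second morphism of every
`𝔼`-triangle. -/
def IsProjective (P : C) : Prop :=
  ∀ ⦃X Y Z : C⦄ (x : X ⟶ Y) (y : Y ⟶ Z), S.Conflation x y →
    ∀ c : P ⟶ Z, ∃ b : P ⟶ Y, b ≫ y = c

/-- Injective objects: morphisms to `I` extend along the first morphism of every `𝔼`-triangle. -/
def IsInjective (I : C) : Prop :=
  ∀ ⦃X Y Z : C⦄ (x : X ⟶ Y) (y : Y ⟶ Z), S.Conflation x y →
    ∀ a : X ⟶ I, ∃ b : Y ⟶ I, x ≫ b = a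

/-- `K` is a syzygy of `Z`: there is an `𝔼`-triangle `K ⟶ P ⟶ Z` with `P` projective. -/
def IsSyzygy (K Z : C) : Prop :=
  ∃ (P : C) (x : K ⟶ P) (y : P ⟶ Z), S.IsProjective P ∧ S.Conflation x y

/-- `L` is a cosyzygy of `X`: there is an `𝔼`-triangle `X ⟶ I ⟶ L` with `I` injective. -/
def IsCosyzygy (L X : C) : Prop :=
  ∃ (I : C) (x : X ⟶ I) (y : I ⟶ L), S.IsInjective I ∧ S.Conflation x y

/-- Enough projectives. -/
class EnoughProjectives : Prop where
  exists_syzygy : ∀ Z : C, ∃ K : C, S.IsSyzygy K Z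

/-- Enough injectives. -/
class EnoughInjectives : Prop where
  exists_cosyzygy : ∀ X : C, ∃ L : C, S.IsCosyzygy L X

/-- A chosen syzygy `Ω Z`. -/
noncomputable def syzygy [S.EnoughProjectives] (Z : C) : C :=
  (EnoughProjectives.exists_syzygy (S := S) Z).choose

/-- The iterated chosen syzygy `Ωⁱ Z`. -/
noncomputable def iterSyzygy [S.EnoughProjectives] : ℕ → C → C
  | 0, Z => Z
  | i + 1, Z => S.syzygy (iterSyzygy i Z)

/-- The higher extension group `𝔼ⁱ⁺¹(Z, X) = 𝔼(Ωⁱ Z, X)`, for `i ≥ 0` (so `higherExt 0` is `𝔼`);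
up to isomorphism it does not depend on the choice of the syzygies. -/
abbrev higherExt [S.EnoughProjectives] (i : ℕ) (Z X : C) : Type w :=
  Ext S.E (S.iterSyzygy i Z) X

/-- `T^⊥`: the objects `Y` with `𝔼ⁱ(X, Y) = 0` for all `i ≥ 1` and all `X` in `T`. -/
def rightPerp [S.EnoughProjectives] (T : ObjectProperty C) : ObjectProperty C :=
  fun Y => ∀ X : C, T X → ∀ (i : ℕ) (ε : S.higherExt i X Y), ε = 0

/-- `Z` has a projective resolution of length `n`: there are `𝔼`-triangles
`Zᵢ₊₁ ⟶ Pᵢ ⟶ Zᵢ` for `0 ≤ i < n` with `Z₀ = Z`, all `Pᵢ` projective, and `Zₙ` projective. -/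
def HasProjectiveResolution : ℕ → C → Prop
  | 0, Z => S.IsProjective Z
  | n + 1, Z => ∃ (K P : C) (x : K ⟶ P) (y : P ⟶ Z),
      S.IsProjective P ∧ S.Conflation x y ∧ HasProjectiveResolution n K

/-- The projective dimension: the minimal length of a projective resolution, `∞` if there is no
resolution of finite length. -/
noncomputable def projDim (Z : C) : ℕ∞ :=
  ⨅ (n : ℕ) (_ : S.HasProjectiveResolution n Z), (n : ℕ∞)

/-- `T` is a generator for `U`: `T ⊆ U`, and every `Y` in `U` is the end of an `𝔼`-triangle
`Y' ⟶ X ⟶ Y` with `X` in `T` and `Y'` in `U`. -/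
def IsGenerator (T U : ObjectProperty C) : Prop :=
  T ≤ U ∧ ∀ Y : C, U Y → ∃ (Y' X : C) (x : Y' ⟶ X) (y : X ⟶ Y),
    T X ∧ U Y' ∧ S.Conflation x y

/-- Tilting subcategories of projective dimension (at most) `n`: full additive subcategories,
closed under isomorphisms and direct summands, such that `pd T ≤ n` and `T` is a generator for
`T^⊥`. A full subcategory is given by its class of objects. -/
structure TiltingSubcategory [S.EnoughProjectives] (n : ℕ) where
  /-- The class of objects. -/
  obj : ObjectProperty C
  isoClosed : obj.IsClosedUnderIsomorphisms
  zero_mem : ∀ Z : C, IsZero Z → obj Z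
  biprod_mem : ∀ X Y : C, obj X → obj Y → obj (X ⊞ Y)
  summand_mem : ∀ X Y : C, obj (X ⊞ Y) → obj X
  projDim_le : ∀ X : C, obj X → S.projDim X ≤ n
  isGenerator : S.IsGenerator obj (S.rightPerp obj)

/-- `T₁ ≤ T₂` if `T₁ ⊆ T₂^⊥`. -/
instance [S.EnoughProjectives] (n : ℕ) : LE (S.TiltingSubcategory n) where
  le T₁ T₂ := T₁.obj ≤ S.rightPerp T₂.obj

end Extriangulation

end Extriang

namespace Extriang

variable {C : Type u} [Category.{v} C]

section Functoriality

variable {E : Cᵒᵖ ⥤ C ⥤ AddCommGrpCat.{w}}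

/-! The key is that `T₁ ≤ T₂` forces `T₁^⊥ ⊆ T₂^⊥` (`rightPerp_le_of_le`). For `Y` in `T₁^⊥` take a
conflation `Y' ⟶ X ⟶ Y` with `X` in `T₁ ⊆ T₂^⊥` and `Y'` in `T₁^⊥`. For `Z` in `T₂`, the vanishing
of `𝔼ⁱ(Z, Y)` follows from that of `𝔼ⁱ⁺¹(Z, Y')`; iterating raises the degree past `pd Z ≤ n`, where
everything vanishes. Transitivity is then immediate. For antisymmetry, `X` in `T₁` is covered by
some `T` in `T₂` with kernel term in `T₂^⊥ ⊆ T₁^⊥`, so the conflation splits and `X` is a summand of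
`T`. -/

@[simp]
theorem push_id {Z X : C} (δ : Ext E Z X) : push (𝟙 X) δ = δ := by
  simp [push]

@[simp]
theorem pull_id {Z X : C} (δ : Ext E Z X) : pull (𝟙 Z) δ = δ := by
  simp [pull]

theorem push_comp {Z X X' X'' : C} (a : X ⟶ X') (b : X' ⟶ X'') (δ : Ext E Z X) :
    push (a ≫ b) δ = push b (push a δ) := by
  simp [push]

theorem pull_comp {Z Z' Z'' X : C} (c : Z'' ⟶ Z') (d : Z' ⟶ Z) (δ : Ext E Z X) :
    pull (c ≫ d) δ = pull c (pull d δ) := by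
  simp [pull]

@[simp]
theorem push_zero {Z X X' : C} (a : X ⟶ X') : push a (0 : Ext E Z X) = 0 :=
  map_zero ((E.obj (op Z)).map a).hom

@[simp]
theorem pull_zero {Z Z' X : C} (c : Z' ⟶ Z) : pull c (0 : Ext E Z X) = 0 :=
  map_zero ((E.map c.op).app X).hom

end Functoriality

namespace Extriangulation

variable [Preadditive C] [HasZeroObject C] [HasBinaryBiproducts C]
  (S : Extriangulation.{w} C)

theorem exists_realization {Z X : C} (δ : Ext S.E Z X) :
    ∃ (Y : C) (x : X ⟶ Y) (y : Y ⟶ Z), S.s δ = SeqClass.mk x y := by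
  obtain ⟨σ, h⟩ := Quotient.exists_rep (S.s δ)
  exact ⟨σ.mid, σ.inl, σ.out, h.symm⟩

/-! ### Exactness of the long sequences attached to a conflation. -/

section Exactness

variable {S} {X Y Z : C} {δ : Ext S.E Z X} {x : X ⟶ Y} {y : Y ⟶ Z}

/-- Compare with the split conflation realizing `0`: a lift of `f` amounts to a morphism of
conflations out of it. -/
theorem pull_eq_zero_iff (h : S.s δ = SeqClass.mk x y) {W : C} (f : W ⟶ Z) :
    pull f δ = 0 ↔ ∃ g : W ⟶ Y, g ≫ y = f := by
  constructor
  · intro hf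
    obtain ⟨b, -, hb⟩ := S.exists_mid _ δ _ _ x y (S.s_zero W X) h (𝟙 X) f (by simp [hf])
    exact ⟨biprod.inr ≫ b, by simp [← hb]⟩
  · rintro ⟨g, rfl⟩
    obtain ⟨a, ha, -⟩ := S.et3_op _ δ _ _ x y (S.s_zero W X) h (biprod.snd ≫ g) (g ≫ y) (by simp)
    simpa using ha.symm

theorem push_eq_zero_iff (h : S.s δ = SeqClass.mk x y) {W : C} (f : X ⟶ W) :
    push f δ = 0 ↔ ∃ g : Y ⟶ W, x ≫ g = f := by
  constructor
  · intro hf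
    obtain ⟨b, hb, -⟩ := S.exists_mid δ _ x y _ _ h (S.s_zero Z W) f (𝟙 Z) (by simp [hf])
    exact ⟨b ≫ biprod.fst, by simp [reassoc_of% hb]⟩
  · rintro ⟨g, rfl⟩
    obtain ⟨c, hc, -⟩ := S.et3 δ _ x y _ _ h (S.s_zero Z W) (x ≫ g) (g ≫ biprod.inl) (by simp)
    simpa using hc

theorem exists_push_of_pull_eq_zero (h : S.s δ = SeqClass.mk x y) {W : C} (ε : Ext S.E Z W)
    (hε : pull y ε = 0) : ∃ f : X ⟶ W, push f δ = ε := by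
  obtain ⟨M, i, p, hM⟩ := S.exists_realization ε
  obtain ⟨g, hg⟩ := (pull_eq_zero_iff hM y).1 hε
  obtain ⟨f, hf, -⟩ := S.et3_op δ ε x y i p h hM g (𝟙 Z) (by simp [hg])
  exact ⟨f, by simpa using hf⟩

theorem exists_pull_of_push_eq_zero (h : S.s δ = SeqClass.mk x y) {W : C} (ε : Ext S.E W X)
    (hε : push x ε = 0) : ∃ f : W ⟶ Z, pull f δ = ε := by
  obtain ⟨M, i, p, hM⟩ := S.exists_realization ε
  obtain ⟨g, hg⟩ := (push_eq_zero_iff hM x).1 hε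
  obtain ⟨f, hf, -⟩ := S.et3 ε δ i p x y hM h (𝟙 X) g (by simp [hg])
  exact ⟨f, by simpa using hf.symm⟩

end Exactness

variable {S}

theorem IsProjective.ext_eq_zero {P Y : C} (hP : S.IsProjective P) (ε : Ext S.E P Y) : ε = 0 := by
  obtain ⟨M, i, p, hM⟩ := S.exists_realization ε
  simpa using (pull_eq_zero_iff hM (𝟙 P)).2 (hP i p ⟨ε, hM⟩ (𝟙 P))

theorem IsInjective.ext_eq_zero {I Z : C} (hI : S.IsInjective I) (ε : Ext S.E Z I) : ε = 0 := by
  obtain ⟨M, i, p, hM⟩ := S.exists_realization ε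
  simpa using (push_eq_zero_iff hM (𝟙 I)).2 (hI i p ⟨ε, hM⟩ (𝟙 I))

/-- If `K` is a syzygy of `Z` and `A ⟶ B ⟶ D` is a conflation, then `𝔼(K, A) = 0` and
`𝔼(Z, B) = 0` imply `𝔼(Z, D) = 0`. -/
theorem IsSyzygy.ext_eq_zero {K Z A B D : C} (hK : S.IsSyzygy K Z) {a : A ⟶ B} {b : B ⟶ D}
    (hab : S.Conflation a b) (hA : ∀ ε : Ext S.E K A, ε = 0) (hB : ∀ ε : Ext S.E Z B, ε = 0)
    (ε : Ext S.E Z D) : ε = 0 := by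
  obtain ⟨P, x, y, hP, ρ, hρ⟩ := hK
  obtain ⟨δ, hδ⟩ := hab
  -- Since `𝔼(P, D) = 0`, `ε` comes from some `f : K ⟶ D`.
  obtain ⟨f, rfl⟩ := exists_push_of_pull_eq_zero hρ ε (hP.ext_eq_zero _)
  -- The obstruction to lifting `f` to `B` lies in `𝔼(K, A)`.
  obtain ⟨g, rfl⟩ := (pull_eq_zero_iff hδ f).1 (hA _)
  rw [push_comp, hB (push g ρ), push_zero]

/-- Dimension shifting: if `K` is a syzygy of `Z` and `L` is a cosyzygy of `Y`, then
`𝔼(K, Y)` vanishes if and only if `𝔼(Z, L)` does. -/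
theorem IsSyzygy.forall_ext_eq_zero_iff {K Z L Y : C} (hK : S.IsSyzygy K Z)
    (hL : S.IsCosyzygy L Y) :
    (∀ ε : Ext S.E K Y, ε = 0) ↔ ∀ ε : Ext S.E Z L, ε = 0 := by
  constructor
  · obtain ⟨I, i, j, hI, hij⟩ := hL
    exact fun h => hK.ext_eq_zero hij h hI.ext_eq_zero
  · intro h ε
    obtain ⟨P, x, y, hP, ρ, hρ⟩ := hK
    obtain ⟨I, i, j, hI, δ, hδ⟩ := hL
    obtain ⟨f, rfl⟩ := exists_pull_of_push_eq_zero hδ ε (hI.ext_eq_zero _)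
    obtain ⟨g, rfl⟩ := (push_eq_zero_iff hρ f).1 (h _)
    rw [pull_comp, hP.ext_eq_zero (pull g δ), pull_zero]

/-- If `𝔼(Z, Y) = 0`, every conflation `Y ⟶ X ⟶ Z` splits. -/
theorem Conflation.nonempty_iso_biprod {X Y Z : C} {y : Y ⟶ X} {z : X ⟶ Z}
    (h : S.Conflation y z) (hZ : ∀ ε : Ext S.E Z Y, ε = 0) : Nonempty (X ≅ Y ⊞ Z) := by
  obtain ⟨δ, hδ⟩ := h
  obtain rfl := hZ δ
  rw [S.s_zero] at hδ
  obtain ⟨b, -, -⟩ := Quotient.exact hδ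
  exact ⟨b.symm⟩

theorem exists_hasProjectiveResolution_of_projDim_le {Z : C} {n : ℕ} (h : S.projDim Z ≤ n) :
    ∃ m ≤ n, S.HasProjectiveResolution m Z := by
  by_contra! hn
  have : ((n + 1 : ℕ) : ℕ∞) ≤ S.projDim Z :=
    le_iInf fun m => le_iInf fun hm => Nat.cast_le.2
      (Nat.succ_le_of_lt (lt_of_not_ge fun hmn => hn m hmn hm))
  have := Nat.cast_le.1 (this.trans h)
  omega

theorem exists_cosyzygy [S.EnoughInjectives] (Y : C) : ∃ L : C, S.IsCosyzygy L Y :=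
  EnoughInjectives.exists_cosyzygy Y

variable [S.EnoughProjectives]

theorem isSyzygy_iterSyzygy_succ (i : ℕ) (Z : C) :
    S.IsSyzygy (S.iterSyzygy (i + 1) Z) (S.iterSyzygy i Z) :=
  (EnoughProjectives.exists_syzygy (S := S) (S.iterSyzygy i Z)).choose_spec

/-! ### Vanishing of higher extensions above the projective dimension. -/

section HigherExt

variable [S.EnoughInjectives]

/-- A syzygy may be chosen arbitrarily to test the vanishing of higher extensions. -/
theorem IsSyzygy.forall_higherExt_succ_eq_zero {K Z : C} (hK : S.IsSyzygy K Z) (i : ℕ) {Y : C}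
    (h : ∀ ε : S.higherExt i K Y, ε = 0) (ε : S.higherExt (i + 1) Z Y) : ε = 0 := by
  induction i generalizing Y with
  | zero =>
    -- Shifting to the second argument makes the chosen syzygy and `K` comparable: both conditions
    -- become `𝔼(Z, L) = 0`.
    obtain ⟨L, hL⟩ := exists_cosyzygy (S := S) Y
    exact ((isSyzygy_iterSyzygy_succ 0 Z).forall_ext_eq_zero_iff hL).2
      ((hK.forall_ext_eq_zero_iff hL).1 h) ε
  | succ i ih =>
    obtain ⟨L, hL⟩ := exists_cosyzygy (S := S) Y
    exact ((isSyzygy_iterSyzygy_succ (i + 1) Z).forall_ext_eq_zero_iff hL).2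
      (ih (((isSyzygy_iterSyzygy_succ i K).forall_ext_eq_zero_iff hL).1 h)) ε

theorem IsProjective.higherExt_eq_zero {P : C} (hP : S.IsProjective P) (i : ℕ) {Y : C}
    (ε : S.higherExt i P Y) : ε = 0 := by
  induction i generalizing Y with
  | zero => exact hP.ext_eq_zero ε
  | succ i ih =>
    obtain ⟨L, hL⟩ := exists_cosyzygy (S := S) Y
    exact ((isSyzygy_iterSyzygy_succ i P).forall_ext_eq_zero_iff hL).2 ih ε

/-- Each step of the resolution lowers the degree by one, down to a projective object. As `higherExt
i` has degree `i + 1`, `m ≤ i` covers all degrees above `m`. -/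
theorem HasProjectiveResolution.higherExt_eq_zero {m : ℕ} {Z : C}
    (hZ : S.HasProjectiveResolution m Z) {i : ℕ} (hi : m ≤ i) {Y : C}
    (ε : S.higherExt i Z Y) : ε = 0 := by
  induction m generalizing Z i with
  | zero => exact IsProjective.higherExt_eq_zero hZ i ε
  | succ m ih =>
    obtain ⟨K, P, x, y, hP, hxy, hK⟩ := hZ
    obtain ⟨j, rfl⟩ := Nat.exists_eq_add_of_lt hi
    exact IsSyzygy.forall_higherExt_succ_eq_zero ⟨P, x, y, hP, hxy⟩ (m + j)
      (ih hK (Nat.le_add_right m j)) ε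

theorem higherExt_eq_zero_of_projDim_le {n : ℕ} {Z : C} (hZ : S.projDim Z ≤ n) {i : ℕ}
    (hi : n ≤ i) {Y : C} (ε : S.higherExt i Z Y) : ε = 0 := by
  obtain ⟨m, hm, h⟩ := exists_hasProjectiveResolution_of_projDim_le hZ
  exact h.higherExt_eq_zero (hm.trans hi) ε

end HigherExt

/-! ### The order on tilting subcategories. -/

namespace TiltingSubcategory

variable {n : ℕ}

theorem obj_injective :
    Function.Injective (TiltingSubcategory.obj : S.TiltingSubcategory n → ObjectProperty C) := by
  rintro ⟨⟩ ⟨⟩ rfl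
  rfl

theorem le_refl (T : S.TiltingSubcategory n) : T ≤ T := T.isGenerator.1

theorem rightPerp_le_of_le [S.EnoughInjectives] {T₁ T₂ : S.TiltingSubcategory n} (h : T₁ ≤ T₂) :
    S.rightPerp T₁.obj ≤ S.rightPerp T₂.obj := by
  -- Descending induction on the degree, uniformly in `Y`: stage `k` handles `i ≥ n - k`, so `k = n`
  -- handles every `i`.
  suffices H : ∀ (k : ℕ) (Y : C), S.rightPerp T₁.obj Y → ∀ Z : C, T₂.obj Z →
      ∀ i : ℕ, n ≤ i + k → ∀ ε : S.higherExt i Z Y, ε = 0 from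
    fun Y hY Z hZ i => H n Y hY Z hZ i (Nat.le_add_left n i)
  intro k
  induction k with
  | zero => exact fun Y _ Z hZ i hi => higherExt_eq_zero_of_projDim_le (T₂.projDim_le Z hZ) hi
  | succ k ih =>
    intro Y hY Z hZ i hi
    obtain ⟨Y', X, x, y, hX, hY', hxy⟩ := T₁.isGenerator.2 Y hY
    exact (isSyzygy_iterSyzygy_succ i Z).ext_eq_zero hxy
      (ih Y' hY' Z hZ (i + 1) (by omega)) (h X hX Z hZ i)

theorem le_trans [S.EnoughInjectives] {T₁ T₂ T₃ : S.TiltingSubcategory n} (h₁₂ : T₁ ≤ T₂)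
    (h₂₃ : T₂ ≤ T₃) : T₁ ≤ T₃ :=
  fun X hX => rightPerp_le_of_le h₂₃ X (h₁₂ X hX)

theorem obj_le_of_le_of_le [S.EnoughInjectives] {T₁ T₂ : S.TiltingSubcategory n} (h₁₂ : T₁ ≤ T₂)
    (h₂₁ : T₂ ≤ T₁) : T₁.obj ≤ T₂.obj := by
  intro X hX
  obtain ⟨Y, T, y, t, hT, hY, hyt⟩ := T₂.isGenerator.2 X (h₁₂ X hX)
  obtain ⟨e⟩ := hyt.nonempty_iso_biprod (rightPerp_le_of_le h₂₁ Y hY X hX 0)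
  have := T₂.isoClosed
  -- The braiding is needed because `summand_mem` extracts the first summand.
  exact T₂.summand_mem X Y (T₂.obj.prop_of_iso (e ≪≫ biprod.braiding Y X) hT)

theorem le_antisymm [S.EnoughInjectives] {T₁ T₂ : S.TiltingSubcategory n} (h₁₂ : T₁ ≤ T₂)
    (h₂₁ : T₂ ≤ T₁) : T₁ = T₂ :=
  obj_injective (_root_.le_antisymm (obj_le_of_le_of_le h₁₂ h₂₁) (obj_le_of_le_of_le h₂₁ h₁₂))

end TiltingSubcategory

end Extriangulation

end Extriang

theorem corollary4p14 {C : Type u} [Category.{v} C] [Preadditive C] [HasZeroObject C] [HasBinaryBiproducts C]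
    (S : Extriang.Extriangulation.{w} C) [S.EnoughProjectives] [S.EnoughInjectives] (n : ℕ) :
    IsPartialOrder (S.TiltingSubcategory n) (fun T₁ T₂ => T₁ ≤ T₂) where
  refl := Extriang.Extriangulation.TiltingSubcategory.le_refl
  trans _ _ _ := Extriang.Extriangulation.TiltingSubcategory.le_trans
  antisymm _ _ := Extriang.Extriangulation.TiltingSubcategory.le_antisymm
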